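/- Let $G=\sum_{n=0}^\infty\frac{(-1)^n}{(2n+1)^2}$ be Catalan's constant. Let $a_1,a_2,a_3,b_2,b_3$ be real numbers and put $$c_{00}=(b_2+b_3)-(a_1+a_2+a_3)-1,\qquad c_{j1}=a_j-1,\qquad c_{jl}=b_l-a_j-1\quad(j=1,2,3;\ l=2,3).$$ Consider the condition $$c_{00},\,c_{21},\,c_{33}\in\mathbb Z+\tfrac12\quad\text{and}\quad c_{22},\,c_{31}\in\mathbb Z. \tag{$*$}$$ Condition $(*)$ is equivalent to: $c_{13},c_{12},c_{32}\in\mathbb Z+\tfrac12$ and $c_{11},c_{23}\in\mathbb Z$. Moreover, if $(*)$ holds and all ten numbers $c_{00},c_{jl}$ $(j,l=1,2,3)$ are $>-1$, then the double integral $$H(\mathbf c)=\int_0^1\!\!\int_0^1\frac{x^{c_{21}}(1-x)^{c_{22}}y^{c_{31}}(1-y)^{c_{33}}}{(1-xy)^{c_{11}+1}}\,dx\,dy$$ converges (absolutely) and $H(\mathbf c)\in\mathbb QG+\mathbb Q$. -/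

import Mathlib

/-- Catalan's constant `G = ∑ (-1)^n / (2 n + 1)^2` (an absolutely convergent series). -/
noncomputable def catalanG : ℝ := ∑' n : ℕ, (-1 : ℝ) ^ n / (2 * (n : ℝ) + 1) ^ 2

/-- `x ∈ ℤ`. -/
def IsInt (x : ℝ) : Prop := ∃ n : ℤ, x = n

/-- `x ∈ ℤ + 1/2`. -/
def IsHalfInt (x : ℝ) : Prop := ∃ n : ℤ, x = n + 1 / 2

/-- The five real parameters `a₁, a₂, a₃; b₂, b₃` of a `₃F₂`-series. -/
structure HyperParams where
  a₁ : ℝ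
  a₂ : ℝ
  a₃ : ℝ
  b₂ : ℝ
  b₃ : ℝ

namespace HyperParams

variable (p : HyperParams)

/-! The ten elements of the set `c`:
`c₀₀ = (b₂ + b₃) - (a₁ + a₂ + a₃) - 1`, `cⱼ₁ = aⱼ - 1`, and `cⱼₗ = bₗ - aⱼ - 1` for `l = 2, 3`. -/

def c₀₀ : ℝ := (p.b₂ + p.b₃) - (p.a₁ + p.a₂ + p.a₃) - 1
def c₁₁ : ℝ := p.a₁ - 1
def c₂₁ : ℝ := p.a₂ - 1
def c₃₁ : ℝ := p.a₃ - 1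
def c₁₂ : ℝ := p.b₂ - p.a₁ - 1
def c₂₂ : ℝ := p.b₂ - p.a₂ - 1
def c₃₂ : ℝ := p.b₂ - p.a₃ - 1
def c₁₃ : ℝ := p.b₃ - p.a₁ - 1
def c₂₃ : ℝ := p.b₃ - p.a₂ - 1
def c₃₃ : ℝ := p.b₃ - p.a₃ - 1

/-- The set `c` of all ten elements. -/
def cSet : Set ℝ :=
  {p.c₀₀, p.c₁₁, p.c₂₁, p.c₃₁, p.c₁₂, p.c₂₂, p.c₃₂, p.c₁₃, p.c₂₃, p.c₃₃}

/-- The arithmetic condition, in terms of `c' = (c₀₀, c₂₁, c₂₂, c₃₃, c₃₁)`. -/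
def DemiIntegral' : Prop :=
  (IsHalfInt p.c₀₀ ∧ IsHalfInt p.c₂₁ ∧ IsHalfInt p.c₃₃) ∧ (IsInt p.c₂₂ ∧ IsInt p.c₃₁)

/-- The arithmetic condition, in terms of `c'' = (c₁₁, c₂₃, c₁₃, c₁₂, c₃₂)`. -/
def DemiIntegral'' : Prop :=
  (IsHalfInt p.c₁₃ ∧ IsHalfInt p.c₁₂ ∧ IsHalfInt p.c₃₂) ∧ (IsInt p.c₁₁ ∧ IsInt p.c₂₃)

/-- The integrand of the double integral `H(c)`, at the point `(x, y) = z`. -/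
noncomputable def integrand (z : ℝ × ℝ) : ℝ :=
  z.1 ^ p.c₂₁ * (1 - z.1) ^ p.c₂₂ * z.2 ^ p.c₃₁ * (1 - z.2) ^ p.c₃₃ /
    (1 - z.1 * z.2) ^ (p.c₁₁ + 1)

/-- The open unit square. -/
def unitSquare : Set (ℝ × ℝ) := Set.Ioo 0 1 ×ˢ Set.Ioo 0 1

/-- The double integral `H(c)` over the unit square. -/
noncomputable def H : ℝ := ∫ z in unitSquare, p.integrand z

end HyperParams

/-! Expanding `(1 - xy)^(-k-1)` in powers of `xy` turns the integral into a series of nonnegative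
terms `C(n+k,k) B(n+p+1/2, q+1) B(n+r+1, s+1/2)` (`betaTerm`), so Tonelli gives convergence and
value together once the series is summed. Contiguity relations then lower the parameters, at the
cost of rational multiples and rational sums. `hasCatalanSum_betaTerm` brings `k` to `0`, where `c₀₀
> -1` enters as `k ≤ q + s`; `hasCatalanSum_betaTerm_zero` brings `q` and `s` to `0`;
`hasCatalanSum_wallisBeta_div` brings `p` and `r` to `0`. What remains is `∑ B(n+1, 1/2) / (n + 1/2)
= 8 G` (`hasSum_wallisBeta_div`), the only source of `G`. -/

open MeasureTheory Set Filter Topology ProbabilityTheory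

/-! ### Termwise integration -/

/-- Tonelli's theorem for a series of nonnegative functions whose integrals are summable. -/
theorem integrable_and_integral_eq_of_hasSum {α : Type*} [MeasurableSpace α] {μ : Measure α}
    {f : ℕ → α → ℝ} {F : α → ℝ} {S : ℝ} (hf : ∀ n, Integrable (f n) μ)
    (h0 : ∀ n, ∀ᵐ x ∂μ, 0 ≤ f n x) (hF : ∀ᵐ x ∂μ, HasSum (fun n => f n x) (F x))
    (hS : HasSum (fun n => ∫ x, f n x ∂μ) S) : Integrable F μ ∧ ∫ x, F x ∂μ = S := by
  have h0' : ∀ᵐ x ∂μ, ∀ n, 0 ≤ f n x := ae_all_iff.2 h0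
  have hi0 : ∀ n, 0 ≤ ∫ x, f n x ∂μ := fun n => integral_nonneg_of_ae (h0 n)
  have hFm : AEStronglyMeasurable F μ := by
    refine aestronglyMeasurable_of_tendsto_ae (f := fun (N : ℕ) x => ∑ n ∈ Finset.range N, f n x)
      atTop (fun N => ?_) ?_
    · exact (integrable_finsetSum _ fun n _ => hf n).1
    · filter_upwards [hF] with x hx using hx.tendsto_sum_nat
  have hlin : ∫⁻ x, ENNReal.ofReal (F x) ∂μ = ENNReal.ofReal S := by
    have : ∀ᵐ x ∂μ, ENNReal.ofReal (F x) = ∑' n, ENNReal.ofReal (f n x) := by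
      filter_upwards [hF, h0'] with x hx hx0
      rw [← hx.tsum_eq, ENNReal.ofReal_tsum_of_nonneg hx0 hx.summable]
    rw [lintegral_congr_ae this, lintegral_tsum fun n => (hf n).1.aemeasurable.ennreal_ofReal,
      ← hS.tsum_eq, ENNReal.ofReal_tsum_of_nonneg hi0 hS.summable]
    congr 1 with n
    rw [ofReal_integral_eq_lintegral_ofReal (hf n) (h0 n)]
  have hF0 : 0 ≤ᵐ[μ] F := by
    filter_upwards [hF, h0'] with x hx hx0 using hx.nonneg hx0
  have hint : Integrable F μ :=
    (lintegral_ofReal_ne_top_iff_integrable hFm hF0).1 (by simp [hlin])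
  refine ⟨hint, ?_⟩
  rw [integral_eq_lintegral_of_nonneg_ae hF0 hFm, hlin,
    ENNReal.toReal_ofReal (hS.nonneg hi0)]

/-- Termwise integration of a series of nonnegative functions with integrable sum. -/
theorem hasSum_integral_of_nonneg {α : Type*} [MeasurableSpace α] {μ : Measure α}
    {f : ℕ → α → ℝ} {F : α → ℝ} (hf : ∀ n, AEStronglyMeasurable (f n) μ)
    (h0 : ∀ n, ∀ᵐ x ∂μ, 0 ≤ f n x) (hF : ∀ᵐ x ∂μ, HasSum (fun n => f n x) (F x))
    (hint : Integrable F μ) : HasSum (fun n => ∫ x, f n x ∂μ) (∫ x, F x ∂μ) := by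
  refine hasSum_integral_of_dominated_convergence f hf (fun n => ?_) ?_ ?_ hF
  · filter_upwards [h0 n] with x hx
    rw [Real.norm_of_nonneg hx]
  · filter_upwards [hF] with x hx using hx.summable
  · refine hint.congr ?_
    filter_upwards [hF] with x hx using hx.tsum_eq.symm

/-! ### Beta integrals and their recurrences -/

theorem integrableOn_rpow_mul_one_sub_rpow {u v : ℝ} (hu : 0 < u) (hv : 0 < v) :
    IntegrableOn (fun x : ℝ => x ^ (u - 1) * (1 - x) ^ (v - 1)) (Ioo 0 1) ∧
      ∫ x in Ioo (0 : ℝ) 1, x ^ (u - 1) * (1 - x) ^ (v - 1) = beta u v := by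
  have hc := Complex.betaIntegral_convergent (u := u) (v := v) (by simpa) (by simpa)
  rw [intervalIntegrable_iff_integrableOn_Ioo_of_le zero_le_one] at hc
  have hcongr : ∀ x ∈ Ioo (0 : ℝ) 1, ((x : ℂ) ^ ((u : ℂ) - 1) * (1 - (x : ℂ)) ^ ((v : ℂ) - 1))
      = ((x ^ (u - 1) * (1 - x) ^ (v - 1) : ℝ) : ℂ) := by
    intro x hx
    have h1 : (0 : ℝ) ≤ 1 - x := by linarith [hx.2]
    push_cast [Complex.ofReal_cpow hx.1.le, Complex.ofReal_cpow h1]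
    rfl
  have hi : IntegrableOn (fun x : ℝ => x ^ (u - 1) * (1 - x) ^ (v - 1)) (Ioo 0 1) := by
    refine IntegrableOn.congr_fun hc.re (fun x hx => ?_) measurableSet_Ioo
    rw [hcongr x hx]
    simp
  refine ⟨hi, ?_⟩
  rw [beta_eq_betaIntegralReal u v hu hv, Complex.betaIntegral,
    intervalIntegral.integral_of_le zero_le_one, integral_Ioc_eq_integral_Ioo,
    setIntegral_congr_fun measurableSet_Ioo hcongr, integral_complex_ofReal, Complex.ofReal_re]

theorem beta_succ_left {u v : ℝ} (hu : 0 < u) (hv : 0 < v) :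
    (u + v) * beta (u + 1) v = u * beta u v := by
  have h1 := (Real.Gamma_pos_of_pos (add_pos hu hv)).ne'
  have h2 := (add_pos hu hv).ne'
  rw [beta, beta, Real.Gamma_add_one hu.ne', show u + 1 + v = u + v + 1 by ring,
    Real.Gamma_add_one h2]
  field_simp

theorem mul_beta_succ_right {u v : ℝ} (hu : 0 < u) (hv : 0 < v) :
    u * beta u (v + 1) = v * beta (u + 1) v := by
  rw [beta, beta, Real.Gamma_add_one hu.ne', Real.Gamma_add_one hv.ne',
    show u + 1 + v = u + (v + 1) by ring]
  ring

theorem beta_succ_right {u v : ℝ} (hu : 0 < u) (hv : 0 < v) :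
    beta u (v + 1) = beta u v - beta (u + 1) v := by
  have h1 := beta_succ_left hu hv
  have h2 := mul_beta_succ_right hu hv
  apply mul_left_cancel₀ hu.ne'
  linarith

theorem beta_one_right {u : ℝ} (hu : 0 < u) : beta u 1 = 1 / u := by
  have := (Real.Gamma_pos_of_pos hu).ne'
  rw [beta, Real.Gamma_add_one hu.ne', Real.Gamma_one]
  field_simp

theorem beta_one_left {v : ℝ} (hv : 0 < v) : beta 1 v = 1 / v := by
  have := (Real.Gamma_pos_of_pos hv).ne'
  rw [beta, add_comm, Real.Gamma_add_one hv.ne', Real.Gamma_one]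
  field_simp

theorem beta_nat_half_rational (m s : ℕ) : ∃ c : ℚ, beta (m + 1) (s + 1 / 2) = c := by
  induction m with
  | zero =>
    refine ⟨1 / (s + 1 / 2), ?_⟩
    rw [Nat.cast_zero, zero_add, beta_one_left (by positivity)]
    push_cast
    rfl
  | succ m ih =>
    obtain ⟨c, hc⟩ := ih
    refine ⟨(m + 1) * c / (m + 1 + (s + 1 / 2)), ?_⟩
    have h := beta_succ_left (u := (m : ℝ) + 1) (v := (s : ℝ) + 1 / 2) (by positivity)
      (by positivity)
    push_cast
    rw [← hc, ← h]
    have : (m : ℝ) + 1 + (s + 1 / 2) ≠ 0 := by positivity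
    field_simp

/-! ### Series with sum in `ℚ G + ℚ` -/

/-- `f` has a sum lying in `ℚ G + ℚ`. -/
def HasCatalanSum (f : ℕ → ℝ) : Prop :=
  ∃ q r : ℚ, HasSum f ((q : ℝ) * catalanG + (r : ℝ))

namespace HasCatalanSum

theorem add {f g : ℕ → ℝ} (hf : HasCatalanSum f) (hg : HasCatalanSum g) :
    HasCatalanSum fun n => f n + g n := by
  obtain ⟨q, r, h⟩ := hf
  obtain ⟨q', r', h'⟩ := hg
  refine ⟨q + q', r + r', ?_⟩
  convert! h.add h' using 1
  push_cast
  ring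

theorem const_mul {f : ℕ → ℝ} (c : ℚ) (hf : HasCatalanSum f) :
    HasCatalanSum fun n => (c : ℝ) * f n := by
  obtain ⟨q, r, h⟩ := hf
  refine ⟨c * q, c * r, ?_⟩
  convert! h.mul_left (c : ℝ) using 1
  push_cast
  ring

theorem sub {f g : ℕ → ℝ} (hf : HasCatalanSum f) (hg : HasCatalanSum g) :
    HasCatalanSum fun n => f n - g n := by
  convert! hf.add (hg.const_mul (-1)) using 2
  push_cast
  ring

theorem of_rat {f : ℕ → ℝ} {c : ℚ} (hf : HasSum f c) : HasCatalanSum f :=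
  ⟨0, c, by simpa using hf⟩

theorem tail {f : ℕ → ℝ} (hf : HasCatalanSum f) {c : ℚ} (h0 : f 0 = c) :
    HasCatalanSum fun n => f (n + 1) := by
  obtain ⟨q, r, h⟩ := hf
  refine ⟨q, r - c, ?_⟩
  rw [hasSum_nat_add_iff (f := f) 1]
  convert! h using 1
  simp [h0]
  ring

end HasCatalanSum

/-! ### The Wallis-type series and its contiguity -/

/-- `B(n + 1, 1/2)`. -/
noncomputable def wallisBeta (n : ℕ) : ℝ := beta (n + 1) (1 / 2)

theorem wallisBeta_zero : wallisBeta 0 = 2 := by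
  rw [wallisBeta, Nat.cast_zero, zero_add, beta_one_left (by norm_num)]
  norm_num

theorem wallisBeta_succ (n : ℕ) : (n + 3 / 2) * wallisBeta (n + 1) = (n + 1) * wallisBeta n := by
  have h := beta_succ_left (u := (n : ℝ) + 1) (v := 1 / 2) (by positivity) (by norm_num)
  rw [wallisBeta, wallisBeta]
  push_cast
  rw [← h]
  ring

theorem wallisBeta_pos (n : ℕ) : 0 < wallisBeta n := beta_pos (by positivity) (by norm_num)

theorem wallisBeta_rational (n : ℕ) : ∃ c : ℚ, wallisBeta n = c := by
  simpa [wallisBeta] using beta_nat_half_rational n 0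

/-- The induction step reduces to `(n + 1)(n + 2) ≤ (n + 3/2)^2`. Only the resulting decay to `0`
matters, for telescoping. -/
theorem wallisBeta_sq_le (n : ℕ) : wallisBeta n ^ 2 ≤ 4 / (n + 1) := by
  induction n with
  | zero => norm_num [wallisBeta_zero]
  | succ n ih =>
    have h : wallisBeta (n + 1) = (n + 1) / (n + 3 / 2) * wallisBeta n := by
      rw [div_mul_eq_mul_div, ← wallisBeta_succ]
      field_simp
    rw [h, mul_pow]
    calc _ ≤ (((n : ℝ) + 1) / (n + 3 / 2)) ^ 2 * (4 / (n + 1)) := by gcongr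
      _ ≤ _ := by
        push_cast
        rw [div_pow, div_mul_div_comm, div_le_div_iff₀ (by positivity) (by positivity)]
        have : (0 : ℝ) ≤ n := n.cast_nonneg
        nlinarith [mul_nonneg this this]

theorem tendsto_wallisBeta : Tendsto wallisBeta atTop (𝓝 0) := by
  have h : Tendsto (fun n => wallisBeta n ^ 2) atTop (𝓝 0) := by
    refine squeeze_zero (fun n => sq_nonneg _) wallisBeta_sq_le ?_
    have := (tendsto_one_div_add_atTop_nhds_zero_nat (𝕜 := ℝ)).const_mul 4
    simpa [div_eq_mul_inv] using this
  have h2 := (Real.continuous_sqrt.tendsto 0).comp h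
  rw [Real.sqrt_zero] at h2
  refine h2.congr fun n => ?_
  simp [Real.sqrt_sq (wallisBeta_pos n).le]

theorem hasSum_wallisBeta_sub (r : ℕ) :
    HasSum (fun n => wallisBeta (n + r) - wallisBeta (n + r + 1)) (wallisBeta r) := by
  rw [hasSum_iff_tendsto_nat_of_nonneg]
  · have h : ∀ N, ∑ n ∈ Finset.range N, (wallisBeta (n + r) - wallisBeta (n + r + 1))
        = wallisBeta r - wallisBeta (N + r) := by
      intro N
      have := Finset.sum_range_sub' (fun n => wallisBeta (n + r)) N
      simp only [zero_add] at this
      rw [← this]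
      refine Finset.sum_congr rfl fun n _ => ?_
      rw [show n + r + 1 = n + 1 + r by ring]
    simp only [h]
    simpa using (tendsto_const_nhds (x := wallisBeta r)).sub
      (tendsto_wallisBeta.comp (tendsto_add_atTop_nat r))
  · intro n
    have h := wallisBeta_succ (n + r)
    have h1 := wallisBeta_pos (n + r + 1)
    have h2 := wallisBeta_pos (n + r)
    have h3 : (0 : ℝ) ≤ (n + r : ℕ) := Nat.cast_nonneg _
    nlinarith

theorem hasCatalanSum_wallisBeta_sub (r : ℕ) :
    HasCatalanSum fun n => wallisBeta (n + r) - wallisBeta (n + r + 1) := by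
  obtain ⟨c, hc⟩ := wallisBeta_rational r
  exact .of_rat (hc ▸ hasSum_wallisBeta_sub r)

/-- The contiguity relation between the series `∑ B(n + r + 1, 1/2) / (n + p + 1/2)`. -/
theorem wallisBeta_contiguous (p r n : ℕ) :
    ((r : ℝ) - p + 1 / 2) * (wallisBeta (n + r) / (n + p + 1 / 2))
      - (r - p + 1) * (wallisBeta (n + r + 1) / (n + p + 1 / 2))
      = -(wallisBeta (n + r) - wallisBeta (n + r + 1)) := by
  have h := wallisBeta_succ (n + r)
  push_cast at h
  have : (n : ℝ) + p + 1 / 2 ≠ 0 := by positivity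
  field_simp
  linarith

/-- Two moves reach every `(p, r)` from `(0, 0)`: dropping the first term raises both indices, and
contiguity changes `r` alone. Contiguity is solved only for a term with nonzero coefficient: `r + 1`
on the row `p = 0`, and `-(p + 1/2)` at `(p + 1, 0)`. -/
theorem hasCatalanSum_wallisBeta_div
    (h0 : HasCatalanSum fun n => wallisBeta n / (n + 1 / 2)) (p r : ℕ) :
    HasCatalanSum fun n => wallisBeta (n + r) / (n + p + 1 / 2) := by
  have hshift : ∀ p r : ℕ, HasCatalanSum (fun n => wallisBeta (n + r) / (n + p + 1 / 2)) →
      HasCatalanSum (fun n => wallisBeta (n + (r + 1)) / (n + (p + 1 : ℕ) + 1 / 2)) := by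
    intro p r h
    obtain ⟨c, hc⟩ := wallisBeta_rational r
    convert! h.tail (c := c / (p + 1 / 2)) (by simp [hc]) using 3 with n
    · congr 1
      ring
    · push_cast
      ring
  induction p generalizing r with
  | zero =>
    induction r with
    | zero => simpa using h0
    | succ r ih =>
      convert! ((ih.const_mul (r + 1 / 2)).add (hasCatalanSum_wallisBeta_sub r)).const_mul
        (1 / (r + 1)) using 2 with n
      have h := wallisBeta_contiguous 0 r n
      push_cast at h ⊢
      rw [show n + (r + 1) = n + r + 1 by ring]
      have : (r : ℝ) + 1 ≠ 0 := by positivity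
      field_simp at h ⊢
      linarith
  | succ p ih =>
    cases r with
    | succ r => exact hshift p r (ih r)
    | zero =>
      convert! (((hshift p 0 (ih 0)).const_mul p).add
        (hasCatalanSum_wallisBeta_sub 0)).const_mul (1 / (p + 1 / 2)) using 2 with n
      have h := wallisBeta_contiguous (p + 1) 0 n
      push_cast at h ⊢
      simp only [add_zero] at h ⊢
      have : (p : ℝ) + 1 / 2 ≠ 0 := by positivity
      rw [one_div_mul_eq_div, eq_div_iff this]
      linarith

/-! ### Evaluation of the base series -/

theorem integral_pow_mul_neg_log (m : ℕ) :
    IntegrableOn (fun u : ℝ => u ^ m * -Real.log u) (Ioo 0 1) ∧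
      ∫ u in Ioo (0 : ℝ) 1, u ^ m * -Real.log u = 1 / ((m : ℝ) + 1) ^ 2 := by
  have hi : IntervalIntegrable (fun u : ℝ => u ^ m * -Real.log u) volume 0 1 :=
    (intervalIntegral.intervalIntegrable_log' (a := 0) (b := 1)).neg.continuousOn_mul
      (by fun_prop)
  refine ⟨(intervalIntegrable_iff_integrableOn_Ioo_of_le zero_le_one).1 hi, ?_⟩
  rw [← integral_Ioc_eq_integral_Ioo, ← intervalIntegral.integral_of_le zero_le_one,
    intervalIntegral.integral_eq_sub_of_hasDerivAt_of_le zero_le_one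
      -- The logarithm is kept in the product `u * log u`, which is continuous at `0`.
      (f := fun u => u ^ m * u * (1 / ((m : ℝ) + 1) ^ 2) - u ^ m * (u * Real.log u) / (m + 1))
      ?_ ?_ hi]
  · simp
  · have := Real.continuous_mul_log
    fun_prop
  · intro u hu
    have hu0 : u ≠ 0 := hu.1.ne'
    have h1 : HasDerivAt (fun u : ℝ => u ^ (m + 1)) (((m + 1 : ℕ) : ℝ) * u ^ m) u := by
      simpa using hasDerivAt_pow (m + 1) u
    have h2 := (h1.mul_const (1 / ((m : ℝ) + 1) ^ 2)).sub
      ((h1.mul (Real.hasDerivAt_log hu0)).div_const ((m : ℝ) + 1))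
    convert! h2 using 1
    · funext x
      simp [pow_succ]
      ring
    · have : (m : ℝ) + 1 ≠ 0 := by positivity
      push_cast
      field_simp
      ring

theorem integral_neg_log_div_one_add_sq :
    IntegrableOn (fun u : ℝ => -Real.log u / (1 + u ^ 2)) (Ioo 0 1) ∧
      ∫ u in Ioo (0 : ℝ) 1, -Real.log u / (1 + u ^ 2) = catalanG := by
  constructor
  · have hi : IntervalIntegrable (fun u : ℝ => -Real.log u * (1 + u ^ 2)⁻¹) volume 0 1 := by
      refine (intervalIntegral.intervalIntegrable_log' (a := 0) (b := 1)).neg.mul_continuousOn ?_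
      exact (Continuous.inv₀ (by fun_prop) fun x => by positivity).continuousOn
    simpa only [div_eq_mul_inv] using
      (intervalIntegrable_iff_integrableOn_Ioo_of_le zero_le_one).1 hi
  · have hF (k : ℕ) := (integral_pow_mul_neg_log (2 * k))
    have hnorm : ∀ k : ℕ, ∫ u in Ioo (0 : ℝ) 1, ‖(-1 : ℝ) ^ k * (u ^ (2 * k) * -Real.log u)‖
        = 1 / ((2 * k : ℕ) + 1 : ℝ) ^ 2 := by
      intro k
      rw [← (hF k).2]
      refine setIntegral_congr_fun measurableSet_Ioo fun u hu => ?_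
      have := Real.log_nonpos hu.1.le hu.2.le
      have h0 := pow_nonneg hu.1.le (2 * k)
      simp only [norm_mul, norm_pow, norm_neg, norm_one, one_pow, one_mul]
      rw [Real.norm_of_nonneg hu.1.le, Real.norm_of_nonpos this]
    have hsum := hasSum_integral_of_summable_integral_norm (μ := volume.restrict (Ioo (0 : ℝ) 1))
      (F := fun (k : ℕ) u => (-1 : ℝ) ^ k * (u ^ (2 * k) * -Real.log u))
      (fun k => (hF k).1.const_mul _) (by
        simp only [hnorm]
        have h := ((summable_nat_add_iff 1).2
          (Real.summable_one_div_nat_pow.2 (one_lt_two : 1 < 2)))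
        refine Summable.of_nonneg_of_le (fun k => by positivity) (fun k => ?_) h
        push_cast
        gcongr
        linarith [(Nat.cast_nonneg k : (0 : ℝ) ≤ k)])
    simp only [integral_const_mul, (hF _).2] at hsum
    rw [catalanG]
    have h2 : ∀ n : ℕ, (-1 : ℝ) ^ n / (2 * (n : ℝ) + 1) ^ 2
        = (-1) ^ n * (1 / (((2 * n : ℕ) : ℝ) + 1) ^ 2) := by
      intro n
      push_cast
      ring
    simp only [h2]
    rw [hsum.tsum_eq]
    refine setIntegral_congr_fun measurableSet_Ioo fun u hu => ?_
    have hlt : ‖-u ^ 2‖ < 1 := by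
      rw [norm_neg, norm_pow, Real.norm_of_nonneg hu.1.le]
      exact pow_lt_one₀ hu.1.le hu.2 two_ne_zero
    have h3 := (hasSum_geometric_of_norm_lt_one hlt).mul_right (-Real.log u)
    have h4 : ∀ k : ℕ, (-u ^ 2) ^ k * -Real.log u = (-1) ^ k * (u ^ (2 * k) * -Real.log u) := by
      intro k
      rw [neg_pow, pow_mul]
      ring
    simp only [h4] at h3
    simp only [h3.tsum_eq]
    rw [sub_neg_eq_add]
    ring

/-- The integral of an odd power of a cosine, rationally parametrized. -/
theorem wallisBeta_eq_integral (n : ℕ) :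
    wallisBeta n =
      ∫ u in (0 : ℝ)..1, ((1 - u ^ 2) / (1 + u ^ 2)) ^ (2 * n + 1) * (4 / (1 + u ^ 2)) := by
  have hpos : ∀ u : ℝ, 1 + u ^ 2 ≠ 0 := fun u => by positivity
  have hs : ∀ u : ℝ, HasDerivAt (fun u : ℝ => 2 * u / (1 + u ^ 2))
      (2 * ((1 - u ^ 2) / (1 + u ^ 2)) / (1 + u ^ 2)) u := by
    intro u
    have := ((hasDerivAt_id u).const_mul 2).div ((hasDerivAt_pow 2 u).const_add 1) (hpos u)
    convert! this using 1
    have := hpos u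
    simp
    field_simp
    ring
  have hc : ∀ u : ℝ, HasDerivAt (fun u : ℝ => (1 - u ^ 2) / (1 + u ^ 2))
      (-(2 * (2 * u / (1 + u ^ 2)) / (1 + u ^ 2))) u := by
    intro u
    have := ((hasDerivAt_pow 2 u).const_sub 1).div ((hasDerivAt_pow 2 u).const_add 1) (hpos u)
    convert! this using 1
    have := hpos u
    simp
    field_simp
    ring
  have hcont : ∀ k : ℕ, Continuous fun u : ℝ =>
      ((1 - u ^ 2) / (1 + u ^ 2)) ^ k * (4 / (1 + u ^ 2)) := by
    intro k
    fun_prop (disch := exact hpos _)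
  induction n with
  | zero =>
    rw [wallisBeta_zero, intervalIntegral.integral_eq_sub_of_hasDerivAt
      (f := fun u => 2 * (2 * u / (1 + u ^ 2)))
      (fun u _ => by convert! (hs u).const_mul 2 using 1; ring)
      ((hcont _).intervalIntegrable _ _)]
    norm_num
  | succ n ih =>
    -- With `s = sin θ`, `c = cos θ`, `u = tan (θ/2)`, this is the usual reduction by
    -- differentiating `2 s c^(2n+2)`; the boundary terms vanish since `s = 0` at `u = 0` and `c =
    -- 0` at `u = 1`.
    have hd : ∀ u : ℝ, HasDerivAt
        (fun u : ℝ => 2 * (2 * u / (1 + u ^ 2)) * ((1 - u ^ 2) / (1 + u ^ 2)) ^ (2 * n + 2))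
        ((2 * n + 3) * (((1 - u ^ 2) / (1 + u ^ 2)) ^ (2 * (n + 1) + 1) * (4 / (1 + u ^ 2)))
          - (2 * n + 2) * (((1 - u ^ 2) / (1 + u ^ 2)) ^ (2 * n + 1) * (4 / (1 + u ^ 2)))) u := by
      intro u
      convert! ((hs u).const_mul 2).mul ((hc u).pow (2 * n + 2)) using 1
      have hsc : (2 * u / (1 + u ^ 2)) ^ 2 = 1 - ((1 - u ^ 2) / (1 + u ^ 2)) ^ 2 := by
        have := hpos u
        field_simp
        ring
      simp only [Pi.pow_apply]
      generalize 2 * u / (1 + u ^ 2) = s at *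
      generalize (1 - u ^ 2) / (1 + u ^ 2) = c at *
      rw [show 2 * n + 2 - 1 = 2 * n + 1 by omega]
      push_cast
      have e : c ^ (2 * (n + 1) + 1) = c ^ (2 * n + 1) * c ^ 2 := by ring
      have e' : c ^ (2 * n + 2) = c ^ (2 * n + 1) * c := by ring
      rw [e, e']
      linear_combination (4 / (1 + u ^ 2) * (2 * n + 2) * c ^ (2 * n + 1)) * hsc
    have hint := intervalIntegral.integral_eq_sub_of_hasDerivAt (a := 0) (b := 1)
      (fun u _ => hd u) (((hcont _).const_mul _).sub ((hcont _).const_mul _)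
        |>.intervalIntegrable _ _)
    rw [intervalIntegral.integral_sub (((hcont _).const_mul _).intervalIntegrable _ _)
      (((hcont _).const_mul _).intervalIntegrable _ _), intervalIntegral.integral_const_mul,
      intervalIntegral.integral_const_mul, ← ih] at hint
    norm_num at hint
    have h := wallisBeta_succ n
    have h3 : (2 * (n : ℝ) + 3) ≠ 0 := by positivity
    apply mul_left_cancel₀ h3
    linarith

/-- With `c = (1 - u²)/(1 + u²)`, summing under the integral gives `∑ c^(2n+1)/(n + 1/2) = log ((1 +
c)/(1 - c)) = -2 log u`, leaving `8 ∫ -log u / (1 + u²)`. -/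
theorem hasSum_wallisBeta_div :
    HasSum (fun n : ℕ => wallisBeta n / (n + 1 / 2)) (8 * catalanG) := by
  have hI := integral_neg_log_div_one_add_sq
  have key : HasSum (fun n : ℕ => ∫ u in Ioo (0 : ℝ) 1,
      ((1 - u ^ 2) / (1 + u ^ 2)) ^ (2 * n + 1) * (4 / (1 + u ^ 2)) * (1 / ((n : ℝ) + 1 / 2)))
      (∫ u in Ioo (0 : ℝ) 1, 8 * (-Real.log u / (1 + u ^ 2))) := by
    refine hasSum_integral_of_nonneg (fun n => ?_) (fun n => ?_) ?_ (hI.1.const_mul _)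
    · refine Continuous.aestronglyMeasurable ?_
      fun_prop (disch := intros; positivity)
    · filter_upwards [ae_restrict_mem measurableSet_Ioo] with u hu
      have : 0 ≤ 1 - u ^ 2 := by nlinarith [hu.1, hu.2]
      positivity
    · filter_upwards [ae_restrict_mem measurableSet_Ioo] with u hu
      obtain ⟨hu0, hu1⟩ := hu
      have hp : 0 < 1 + u ^ 2 := by positivity
      have hm : 0 < 1 - u ^ 2 := by nlinarith
      have hc : |(1 - u ^ 2) / (1 + u ^ 2)| < 1 := by
        rw [abs_of_pos (by positivity), div_lt_one hp]
        nlinarith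
      have h := (Real.hasSum_log_sub_log_of_abs_lt_one hc).mul_right (4 / (1 + u ^ 2))
      convert! h using 1
      · funext n
        field_simp
      · rw [← Real.log_div, show (1 + (1 - u ^ 2) / (1 + u ^ 2)) / (1 - (1 - u ^ 2) / (1 + u ^ 2))
          = (u ^ 2)⁻¹ by field_simp; ring, Real.log_inv, Real.log_pow]
        · push_cast
          ring
        · positivity
        · rw [abs_lt] at hc
          linarith [hc.2]
  rw [integral_const_mul, hI.2] at key
  convert! key using 1
  funext n
  rw [integral_mul_const, wallisBeta_eq_integral, intervalIntegral.integral_of_le zero_le_one,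
    integral_Ioc_eq_integral_Ioo, mul_one_div]

/-! ### Reduction of the general series -/

/-- The `n`-th term of the expansion of the double integral in powers of `x y`. -/
noncomputable def betaTerm (k p q r s n : ℕ) : ℝ :=
  (n + k).choose k * beta (n + p + 1 / 2) (q + 1) * beta (n + r + 1) (s + 1 / 2)

theorem hasCatalanSum_betaTerm_zero (p q r s : ℕ) : HasCatalanSum (betaTerm 0 p q r s) := by
  induction q generalizing p with
  | zero =>
    induction s generalizing r with
    | zero =>
      convert! hasCatalanSum_wallisBeta_div ⟨8, 0, by simpa using hasSum_wallisBeta_div⟩ p r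
        using 2 with n
      rw [betaTerm, wallisBeta, Nat.cast_zero, zero_add, beta_one_right (by positivity)]
      push_cast
      simp
      ring
    | succ s ih =>
      convert! (ih r).sub (ih (r + 1)) using 2 with n
      simp only [betaTerm]
      push_cast
      rw [show (s : ℝ) + 1 + 1 / 2 = s + 1 / 2 + 1 by ring,
        beta_succ_right (u := n + r + 1) (by positivity) (by positivity),
        show (n : ℝ) + (r + 1) + 1 = n + r + 1 + 1 by ring]
      ring
  | succ q ih =>
    convert! (ih p).sub (ih (p + 1)) using 2 with n
    simp only [betaTerm]
    push_cast
    rw [beta_succ_right (u := n + p + 1 / 2) (by positivity) (by positivity),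
      show (n : ℝ) + (p + 1) + 1 / 2 = n + p + 1 / 2 + 1 by ring]
    ring

/-- Under the integral the binomial series sums to `(1 - y)^(-k-1)`, which the extra `k + 1` in the
exponent of `1 - y` absorbs. -/
theorem hasSum_choose_mul_beta (k r s : ℕ) :
    HasSum (fun n : ℕ => ((n + k).choose k : ℝ) * beta (n + r + 1) ((s + k + 1 : ℕ) + 1 / 2))
      (beta (r + 1) (s + 1 / 2)) := by
  have hg := integrableOn_rpow_mul_one_sub_rpow (u := (r : ℝ) + 1) (v := (s : ℝ) + 1 / 2)
    (by positivity) (by positivity)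
  have hf := fun n : ℕ => integrableOn_rpow_mul_one_sub_rpow (u := (n : ℝ) + r + 1)
    (v := ((s + k + 1 : ℕ) : ℝ) + 1 / 2) (by positivity) (by positivity)
  have h := hasSum_integral_of_nonneg (fun n => ((hf n).1.const_mul ((n + k).choose k : ℝ)).1)
    (fun n => ?_) ?_ hg.1
  · simpa only [integral_const_mul, (hf _).2, hg.2] using h
  · filter_upwards [ae_restrict_mem measurableSet_Ioo] with y hy
    have : 0 < 1 - y := by linarith [hy.2]
    have := hy.1
    positivity
  · filter_upwards [ae_restrict_mem measurableSet_Ioo] with y hy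
    have h1 : 0 < 1 - y := by linarith [hy.2]
    have h2 := hasSum_choose_mul_geometric_of_norm_lt_one k (r := y)
      (by rw [Real.norm_of_nonneg hy.1.le]; exact hy.2)
    convert! h2.mul_right
      (y ^ ((r : ℝ) + 1 - 1) * (1 - y) ^ (((s + k + 1 : ℕ) : ℝ) + 1 / 2 - 1)) using 1
    · funext n
      rw [show (n : ℝ) + r + 1 - 1 = n + (r + 1 - 1) by ring, Real.rpow_add hy.1,
        Real.rpow_natCast]
      ring
    · rw [show ((s + k + 1 : ℕ) : ℝ) + 1 / 2 - 1 = ((k + 1 : ℕ) : ℝ) + (s + 1 / 2 - 1) by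
        push_cast; ring, Real.rpow_add h1, Real.rpow_natCast]
      field_simp

/-- Splits the factor `n + k + 1` of the binomial recurrence as `(k + 1/2 - p) + (n + p + 1/2)`; the
second summand is the one the first Beta factor can absorb. -/
theorem succ_mul_betaTerm_succ (k p q r s n : ℕ) :
    ((k : ℝ) + 1) * betaTerm (k + 1) p q r s n = (k + 1 / 2 - p) * betaTerm k p q r s n +
      (n + k).choose k * ((n + p + 1 / 2) * beta (n + p + 1 / 2) (q + 1)) *
        beta (n + r + 1) (s + 1 / 2) := by
  have h : ((n + k + 1 : ℕ) : ℝ) * (n + k).choose k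
      = (n + (k + 1)).choose (k + 1) * ((k + 1 : ℕ) : ℝ) := by
    exact_mod_cast Nat.add_one_mul_choose_eq (n + k) k
  rw [betaTerm, betaTerm]
  push_cast at h
  linear_combination (-beta (n + p + 1 / 2) (q + 1) * beta (n + r + 1) (s + 1 / 2)) * h

/-- For `q > 0` the absorbed factor lowers `q` along with `k`, preserving `k ≤ q + s`. For `q = 0`
it cancels the first Beta factor, and the bound leaves enough room in `s` for a rational sum. -/
theorem hasCatalanSum_betaTerm (k p q r s : ℕ) (hk : k ≤ q + s) :
    HasCatalanSum (betaTerm k p q r s) := by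
  induction k generalizing p q with
  | zero => exact hasCatalanSum_betaTerm_zero p q r s
  | succ k ih =>
    have h1 := ih p q (by omega)
    have hk0 : (k : ℝ) + 1 ≠ 0 := by positivity
    cases q with
    | zero =>
      obtain ⟨s', rfl⟩ := Nat.exists_eq_add_of_le (show k + 1 ≤ s by omega)
      have h2 := hasSum_choose_mul_beta k r s'
      obtain ⟨c, hc⟩ := beta_nat_half_rational r s'
      rw [hc] at h2
      convert! ((h1.const_mul (k + 1 / 2 - p)).add (.of_rat h2)).const_mul (1 / (k + 1))
        using 2 with n
      have h := succ_mul_betaTerm_succ k p 0 r (k + 1 + s') n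
      have hu : (n : ℝ) + p + 1 / 2 ≠ 0 := by positivity
      rw [Nat.cast_zero, zero_add, beta_one_right (by positivity), mul_one_div_cancel hu] at h
      rw [show s' + k + 1 = k + 1 + s' by ring]
      push_cast at h ⊢
      rw [one_div_mul_eq_div, eq_div_iff hk0]
      linarith
    | succ q =>
      convert! ((h1.const_mul (k + 1 / 2 - p)).add
        ((ih (p + 1) q (by omega)).const_mul (q + 1))).const_mul (1 / (k + 1)) using 2 with n
      have h := succ_mul_betaTerm_succ k p (q + 1) r s n
      push_cast at h ⊢
      rw [mul_beta_succ_right (u := n + p + 1 / 2) (by positivity) (by positivity)] at h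
      rw [one_div_mul_eq_div, eq_div_iff hk0, mul_comm, h]
      simp only [betaTerm]
      push_cast
      rw [show (n : ℝ) + (p + 1) + 1 / 2 = n + p + 1 / 2 + 1 by ring]
      ring

/-! ### The arithmetic condition and the double integral -/

namespace HyperParams

/-- Each entry of one quintuple has the form `x + y - z` with `x, y, z` in the other, e.g. `c₁₃ =
c₀₀ + c₃₁ - c₂₂`. -/
theorem demiIntegral'_iff (p : HyperParams) : p.DemiIntegral' ↔ p.DemiIntegral'' := by
  simp only [DemiIntegral', DemiIntegral'', IsHalfInt, IsInt, c₀₀, c₁₁, c₂₁, c₃₁, c₁₂, c₂₂, c₃₂,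
    c₁₃, c₂₃, c₃₃]
  constructor
  · rintro ⟨⟨⟨i, hi⟩, ⟨j, hj⟩, ⟨k, hk⟩⟩, ⟨l, hl⟩, ⟨m, hm⟩⟩
    refine ⟨⟨⟨i + m - l, ?_⟩, ⟨i + j - k, ?_⟩, ⟨j + l - m, ?_⟩⟩, ⟨l + k - i, ?_⟩,
      ⟨k + m - j, ?_⟩⟩ <;> push_cast <;> linarith
  · rintro ⟨⟨⟨i, hi⟩, ⟨j, hj⟩, ⟨k, hk⟩⟩, ⟨l, hl⟩, ⟨m, hm⟩⟩
    refine ⟨⟨⟨k + m - l, ?_⟩, ⟨i + l - m, ?_⟩, ⟨i + k - j, ?_⟩⟩, ⟨j + m - i, ?_⟩,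
      ⟨j + l - k, ?_⟩⟩ <;> push_cast <;> linarith

theorem integrand_integrableOn_and_eq (P : HyperParams) {k p q r s : ℕ} (hk : P.c₁₁ = k)
    (hp : P.c₂₁ = p - 1 / 2) (hq : P.c₂₂ = q) (hr : P.c₃₁ = r) (hs : P.c₃₃ = s - 1 / 2)
    {S : ℝ} (hS : HasSum (betaTerm k p q r s) S) :
    IntegrableOn P.integrand unitSquare ∧ P.H = S := by
  have hx := fun n : ℕ => integrableOn_rpow_mul_one_sub_rpow (u := (n : ℝ) + p + 1 / 2)
    (v := (q : ℝ) + 1) (by positivity) (by positivity)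
  have hy := fun n : ℕ => integrableOn_rpow_mul_one_sub_rpow (u := (n : ℝ) + r + 1)
    (v := (s : ℝ) + 1 / 2) (by positivity) (by positivity)
  have hmeas : MeasurableSet unitSquare := measurableSet_Ioo.prod measurableSet_Ioo
  have hprod : (volume : Measure (ℝ × ℝ)).restrict unitSquare =
      (volume.restrict (Ioo (0 : ℝ) 1)).prod (volume.restrict (Ioo (0 : ℝ) 1)) := by
    rw [unitSquare, Measure.volume_eq_prod, Measure.prod_restrict]
  rw [H, IntegrableOn]
  refine integrable_and_integral_eq_of_hasSum
    (f := fun (n : ℕ) (z : ℝ × ℝ) => ((n + k).choose k : ℝ) *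
      ((z.1 ^ ((n : ℝ) + p + 1 / 2 - 1) * (1 - z.1) ^ ((q : ℝ) + 1 - 1)) *
      (z.2 ^ ((n : ℝ) + r + 1 - 1) * (1 - z.2) ^ ((s : ℝ) + 1 / 2 - 1))))
    (fun n => ?_) (fun n => ?_) ?_ ?_
  · rw [hprod]
    exact ((hx n).1.mul_prod (hy n).1).const_mul _
  · filter_upwards [ae_restrict_mem hmeas] with z hz
    obtain ⟨⟨h1, h2⟩, h3, h4⟩ := hz
    have : 0 < 1 - z.1 := by linarith
    have : 0 < 1 - z.2 := by linarith
    positivity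
  · filter_upwards [ae_restrict_mem hmeas] with z hz
    obtain ⟨⟨h1, h2⟩, h3, h4⟩ := hz
    have hxy : z.1 * z.2 < 1 := mul_lt_one_of_nonneg_of_lt_one_left h1.le h2 h4.le
    have h := (hasSum_choose_mul_geometric_of_norm_lt_one k (r := z.1 * z.2)
      (by rw [Real.norm_of_nonneg (by positivity)]; exact hxy)).mul_right
      (z.1 ^ P.c₂₁ * (1 - z.1) ^ P.c₂₂ * z.2 ^ P.c₃₁ * (1 - z.2) ^ P.c₃₃)
    convert! h using 1
    · funext n
      rw [hp, hq, hr, hs, show (n : ℝ) + p + 1 / 2 - 1 = n + (p - 1 / 2) by ring,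
        show (n : ℝ) + r + 1 - 1 = n + r by ring, Real.rpow_add h1, Real.rpow_add h3,
        Real.rpow_natCast, Real.rpow_natCast, mul_pow, add_sub_cancel_right,
        show (s : ℝ) + 1 / 2 - 1 = s - 1 / 2 by ring]
      ring
    · rw [integrand, hk, ← Real.rpow_natCast (1 - z.1 * z.2) (k + 1)]
      push_cast
      ring
  · convert! hS using 1
    funext n
    rw [integral_const_mul, hprod, betaTerm, mul_assoc, ← (hx n).2, ← (hy n).2,
      ← integral_prod_mul]

end HyperParams

theorem mainTheorem4 (p : HyperParams) :
    (p.DemiIntegral' ↔ p.DemiIntegral'') ∧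
    (p.DemiIntegral' → (∀ c ∈ p.cSet, -1 < c) →
      MeasureTheory.IntegrableOn p.integrand HyperParams.unitSquare ∧
      ∃ q r : ℚ, p.H = (q : ℝ) * catalanG + (r : ℝ)) := by
  refine ⟨p.demiIntegral'_iff, fun hd hc => ?_⟩
  obtain ⟨-, ⟨k, hk⟩, -⟩ := p.demiIntegral'_iff.1 hd
  obtain ⟨⟨⟨i, hi⟩, ⟨m, hm⟩, ⟨s, hs⟩⟩, ⟨q, hq⟩, ⟨r, hr⟩⟩ := hd
  simp only [HyperParams.cSet, mem_insert_iff, mem_singleton_iff, forall_eq_or_imp,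
    forall_eq] at hc
  obtain ⟨h00, h11, h21, h31, -, h22, -, -, -, h33⟩ := hc
  have hsum : p.c₀₀ = p.c₂₂ + p.c₃₃ - p.c₁₁ := by
    simp only [HyperParams.c₀₀, HyperParams.c₂₂, HyperParams.c₃₃, HyperParams.c₁₁]
    ring
  rw [hsum, hq, hs, hk] at h00
  rw [hk] at h11
  rw [hm] at h21
  rw [hr] at h31
  rw [hq] at h22
  rw [hs] at h33
  have int_nonneg : ∀ z : ℤ, (-1 : ℝ) < z → 0 ≤ z := fun z hz => by
    have : (-1 : ℤ) < z := by exact_mod_cast hz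
    omega
  have half_nonneg : ∀ z : ℤ, (-1 : ℝ) < z + 1 / 2 → 0 ≤ z + 1 := fun z hz => by
    have : (-2 : ℝ) < z := by linarith
    have : (-2 : ℤ) < z := by exact_mod_cast this
    omega
  -- Here `c₀₀ = q + (s + 1/2) - k`, so `c₀₀ > -1` becomes `k ≤ q + s + 1`, which is `k ≤ q + s'`
  -- for the shifted `s' = s + 1` below.
  have hle := half_nonneg (q + s - k) (by push_cast; linarith)
  lift k to ℕ using int_nonneg k h11
  lift q to ℕ using int_nonneg q h22
  lift r to ℕ using int_nonneg r h31
  obtain ⟨m', hm'⟩ := Int.eq_ofNat_of_zero_le (half_nonneg m h21)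
  obtain ⟨s', hs'⟩ := Int.eq_ofNat_of_zero_le (half_nonneg s h33)
  have em : (m : ℝ) = m' - 1 := by rw [← Int.cast_natCast m', ← hm']; push_cast; ring
  have es : (s : ℝ) = s' - 1 := by rw [← Int.cast_natCast s', ← hs']; push_cast; ring
  obtain ⟨c, d, h⟩ := hasCatalanSum_betaTerm k m' q r s' (by omega)
  obtain ⟨hi, hH⟩ := p.integrand_integrableOn_and_eq (by simpa using hk) (by rw [hm, em]; ring)
    (by simpa using hq) (by simpa using hr) (by rw [hs, es]; ring) h
  exact ⟨hi, c, d, hH⟩
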